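/- Let $p$ be a prime, let $\mathcal{O}$ be a discrete valuation ring of characteristic $0$ whose maximal ideal is $p\mathcal{O}$ (for instance the valuation ring in a $p$-modular system $(k,\mathcal{O},K)$ with $K$ unramified over $\mathbb{Q}_p$), and let $K$ be its field of fractions. Let $\lambda$ be a partition of some $n\in\mathbb{N}$. For a commutative ring $R$ let $M^\lambda_R$ be the free $R$-module on the $\lambda$-tabloids, with the symmetric bilinear form $(-,=)$ for which the tabloids are orthonormal, and let $S^\lambda_R\leq M^\lambda_R$ be the Specht module, i.e. the $R$-span of the polytabloids, equipped with the restriction of this form. Regard $S^\lambda_{\mathcal{O}}$ as an $\mathcal{O}\Sigma_n$-lattice in $S^\lambda_K$, where $\Sigma_n$ is the symmetric group on $n$ points, and let $$S^{\lambda\sharp}_{\mathcal{O}}=\{\,l\in S^\lambda_K \mid (l,S^\lambda_{\mathcal{O}})\subseteq\mathcal{O}\,\}$$ be its dual. For $j\in\mathbb{Z}_{\geq 0}$ put $$\hat S(j)=(p^{-j}S^\lambda_{\mathcal{O}})\cap S^{\lambda\sharp}_{\mathcal{O}},\qquad S^\lambda_{\mathcal{O}}(j)=\{\,m\in S^\lambda_{\mathcal{O}}\mid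 (m,S^\lambda_{\mathcal{O}})\subseteq p^j\mathcal{O}\,\},$$ and let $$S^\lambda_k(j)=\frac{S^\lambda_{\mathcal{O}}(j)+pS^\lambda_{\mathcal{O}}}{pS^\lambda_{\mathcal{O}}}\leq S^\lambda_{\mathcal{O}}/pS^\lambda_{\mathcal{O}}=S^\lambda_k$$ be the $j$-th term of the Jantzen--Schaper filtration, where $k=\mathcal{O}/p\mathcal{O}$. Then there is an ascending filtration $$S^\lambda_{\mathcal{O}}=\hat S(0)\leq\hat S(1)\leq\cdots\leq\hat S(l)=S^{\lambda\sharp}_{\mathcal{O}}\qquad\text{for some } l\in\mathbb{N},$$ and for all $j\geq 1$ the quotient $\hat S(j)/\hat S(j-1)$ is isomorphic to $S^\lambda_k(j)$ as an $\mathcal{O}\Sigma_n$-module. -/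

import Mathlib

open scoped Pointwise

noncomputable section

namespace Specht

/-- The Young diagram of a partition: row `i` (counted from `0`) has as many cells as the
`i`-th largest part. A cell is a pair (row, column). -/
def diagram {n : ℕ} (lam : n.Partition) : YoungDiagram :=
  YoungDiagram.ofRowLens (lam.parts.sort (· ≥ ·))
    (Multiset.pairwise_sort lam.parts (· ≥ ·)).sortedGE

/-- A `lam`-tableau, given by the bijection sending each entry to the cell that contains it. -/
def Tableau {n : ℕ} (lam : n.Partition) : Type :=
  Fin n ≃ (diagram lam).cells

namespace Tableau

variable {n : ℕ} {lam : n.Partition}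

/-- The row of the tableau `t` in which the entry `i` stands. -/
def row (t : Tableau lam) (i : Fin n) : ℕ := (Equiv.toFun t i).1.1

/-- The column of the tableau `t` in which the entry `i` stands. -/
def col (t : Tableau lam) (i : Fin n) : ℕ := (Equiv.toFun t i).1.2

/-- The tableau obtained from `t` by replacing each entry `i` by `g i`. -/
def act (g : Equiv.Perm (Fin n)) (t : Tableau lam) : Tableau lam := Equiv.trans g.symm t

@[simp] theorem row_act (g : Equiv.Perm (Fin n)) (t : Tableau lam) (i : Fin n) :
    (act g t).row i = t.row (g⁻¹ i) := rfl

@[simp] theorem col_act (g : Equiv.Perm (Fin n)) (t : Tableau lam) (i : Fin n) :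
    (act g t).col i = t.col (g⁻¹ i) := rfl

theorem act_one (t : Tableau lam) : act 1 t = t := rfl

theorem act_mul (g h : Equiv.Perm (Fin n)) (t : Tableau lam) :
    act (g * h) t = act g (act h t) := rfl

/-- Two tableaux are row equivalent if each entry stands in the same row of both. -/
def rowSetoid (lam : n.Partition) : Setoid (Tableau lam) where
  r s t := ∀ i, s.row i = t.row i
  iseqv := ⟨fun _ _ => rfl, fun h i => (h i).symm, fun h h' i => (h i).trans (h' i)⟩

/-- The column stabilizer of the tableau `t`. -/
def IsColStable (t : Tableau lam) (g : Equiv.Perm (Fin n)) : Prop :=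
  ∀ i, t.col (g i) = t.col i

end Tableau

/-- A `lam`-tabloid is a row equivalence class of `lam`-tableaux. -/
def Tabloid {n : ℕ} (lam : n.Partition) : Type := Quotient (Tableau.rowSetoid lam)

/-- The tabloid of a tableau. -/
def Tableau.tabloid {n : ℕ} {lam : n.Partition} (t : Tableau lam) : Tabloid lam :=
  Quotient.mk (Tableau.rowSetoid lam) t

instance {n : ℕ} (lam : n.Partition) : Finite (Tabloid lam) :=
  haveI : Finite (Tableau lam) := inferInstanceAs (Finite (Fin n ≃ (diagram lam).cells))
  inferInstanceAs (Finite (Quotient (Tableau.rowSetoid lam)))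

instance {n : ℕ} (lam : n.Partition) : Fintype (Tabloid lam) := Fintype.ofFinite _

/-- The action of the symmetric group on tabloids, `g • {t} = {g t}`. -/
instance {n : ℕ} (lam : n.Partition) : MulAction (Equiv.Perm (Fin n)) (Tabloid lam) where
  smul g := Quotient.map (Tableau.act g) fun _ _ h i => h (g⁻¹ i)
  one_smul T := by
    induction T using Quotient.inductionOn with
    | h t => rfl
  mul_smul g h T := by
    induction T using Quotient.inductionOn with
    | h t => rfl

theorem smul_tabloid {n : ℕ} {lam : n.Partition} (g : Equiv.Perm (Fin n)) (t : Tableau lam) :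
    g • t.tabloid = (t.act g).tabloid := rfl

section

variable (R : Type*) [CommRing R] {n : ℕ} (lam : n.Partition)

/-- The permutation module on the free `R`-module with basis the `lam`-tabloids
(the tabloid `T` is the function `Pi.single T 1`). -/
def permRep : Representation R (Equiv.Perm (Fin n)) (Tabloid lam → R) where
  toFun g := LinearMap.funLeft R R (fun T => g⁻¹ • T)
  map_one' := by ext; simp [LinearMap.funLeft]
  map_mul' g h := by
    refine LinearMap.ext fun x => funext fun T => ?_
    simp [LinearMap.funLeft, mul_smul]

theorem permRep_apply (g : Equiv.Perm (Fin n)) (x : Tabloid lam → R) (T : Tabloid lam) :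
    permRep R lam g x T = x (g⁻¹ • T) := rfl

/-- The bilinear form on the permutation module for which the tabloids are orthonormal. -/
def permForm : LinearMap.BilinForm R (Tabloid lam → R) :=
  LinearMap.mk₂ R (fun x y => ∑ T, x T * y T)
    (fun x y z => by simp [add_mul, Finset.sum_add_distrib])
    (fun c x y => by simp [Finset.mul_sum, mul_assoc])
    (fun x y z => by simp [mul_add, Finset.sum_add_distrib])
    (fun c x y => by simp [Finset.mul_sum, mul_left_comm])

theorem permForm_apply (x y : Tabloid lam → R) : permForm R lam x y = ∑ T, x T * y T := rfl

theorem permForm_permRep (g : Equiv.Perm (Fin n)) (x y : Tabloid lam → R) :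
    permForm R lam (permRep R lam g x) (permRep R lam g y) = permForm R lam x y := by
  simp only [permForm_apply, permRep_apply]
  exact Equiv.sum_comp (MulAction.toPerm g⁻¹) (fun T => x T * y T)

variable {lam} in
open Classical in
/-- The polytabloid of `t`: the signed sum of the tabloids `{g t}` over the column stabilizer. -/
def polytabloid (t : Tableau lam) : Tabloid lam → R :=
  ∑ g : Equiv.Perm (Fin n) with t.IsColStable g,
    (Equiv.Perm.sign g : ℤ) • Pi.single (t.act g).tabloid (1 : R)

variable {lam} in
theorem permRep_polytabloid (g : Equiv.Perm (Fin n)) (t : Tableau lam) :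
    permRep R lam g (polytabloid R t) = polytabloid R (t.act g) := by
  classical
  have key : ∀ T : Tabloid lam, permRep R lam g (Pi.single T (1 : R)) = Pi.single (g • T) 1 := by
    intro T
    funext T'
    simp only [permRep_apply, Pi.single_apply, inv_smul_eq_iff]
  unfold polytabloid
  rw [map_sum]
  refine Finset.sum_equiv (MulAut.conj g).toEquiv ?_ ?_
  · intro h
    rw [Finset.mem_filter_univ, Finset.mem_filter_univ]
    constructor
    · intro hh i
      simpa using hh (g⁻¹ i)
    · intro hh i
      simpa using hh (g i)
  · intro h _
    rw [map_zsmul, key, smul_tabloid, ← Tableau.act_mul]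
    have h1 : Equiv.Perm.sign ((MulAut.conj g).toEquiv h) = Equiv.Perm.sign h := by
      simp [mul_right_comm]
    have h2 : (t.act g).act ((MulAut.conj g).toEquiv h) = t.act (g * h) := by
      rw [← Tableau.act_mul]
      simp
    rw [h1, h2]

/-- The Specht module over `R`: the `R`-span of the polytabloids in the permutation module. -/
def specht : Subrepresentation (permRep R lam) where
  toSubmodule := Submodule.span R (Set.range (polytabloid R (lam := lam)))
  apply_mem_toSubmodule g v hv := by
    induction hv using Submodule.span_induction with
    | mem x hx =>
      obtain ⟨t, rfl⟩ := hx
      rw [permRep_polytabloid]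
      exact Submodule.subset_span ⟨_, rfl⟩
    | zero => simp
    | add x y _ _ hx hy => rw [map_add]; exact add_mem hx hy
    | smul c x _ hx => rw [map_smul]; exact Submodule.smul_mem _ _ hx

/-- The underlying `R`-module of the Specht module. -/
abbrev SpechtModule : Type _ := (specht R lam).toSubmodule

/-- The action of the symmetric group on the Specht module. -/
abbrev spechtRep : Representation R (Equiv.Perm (Fin n)) (SpechtModule R lam) :=
  (specht R lam).toRepresentation

/-- The natural bilinear form on the Specht module, inherited from the permutation module. -/
def spechtForm : LinearMap.BilinForm R (SpechtModule R lam) :=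
  (permForm R lam).restrict (specht R lam).toSubmodule

theorem spechtForm_apply (x y : SpechtModule R lam) :
    spechtForm R lam x y = ∑ T, (x : Tabloid lam → R) T * (y : Tabloid lam → R) T := rfl

theorem spechtForm_spechtRep (g : Equiv.Perm (Fin n)) (x y : SpechtModule R lam) :
    spechtForm R lam (spechtRep R lam g x) y
      = spechtForm R lam x (spechtRep R lam g⁻¹ y) := by
  have h := permForm_permRep R lam g (x : Tabloid lam → R) (permRep R lam g⁻¹ y)
  rw [Representation.self_inv_apply] at h
  exact h

/-- The submodule `{m | (m, S) ⊆ p ^ i R}` of the Specht module `S` over `R`. -/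
def jantzen (p : R) (i : ℕ) : Subrepresentation (spechtRep R lam) where
  toSubmodule :=
    { carrier := {m | ∀ y, p ^ i ∣ spechtForm R lam m y}
      add_mem' := fun ha hb y => by
        rw [map_add, LinearMap.add_apply]; exact dvd_add (ha y) (hb y)
      zero_mem' := fun y => by simp
      smul_mem' := fun c x hx y => by
        rw [map_smul, LinearMap.smul_apply]; exact (hx y).mul_left c }
  apply_mem_toSubmodule g v hv y := by
    rw [spechtForm_spechtRep]; exact hv _

/-- The submodule `p S` of the Specht module `S` over `R`. -/
def pSpecht (p : R) : Subrepresentation (spechtRep R lam) where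
  toSubmodule := p • (⊤ : Submodule R (SpechtModule R lam))
  apply_mem_toSubmodule g v hv := by
    obtain ⟨w, -, rfl⟩ := hv
    exact ⟨spechtRep R lam g w, trivial, (map_smul (spechtRep R lam g) p w).symm⟩

/-- The action of the symmetric group on `S / p S`, the reduction of the Specht module `S`. -/
def reductionRep (p : R) : Representation R (Equiv.Perm (Fin n))
    (SpechtModule R lam ⧸ (pSpecht R lam p).toSubmodule) :=
  (spechtRep R lam).quotient (pSpecht R lam p).toSubmodule
    (fun g _ hx => (pSpecht R lam p).apply_mem_toSubmodule g hx)

/-- The `i`-th term `(S(i) + p S) / p S ≤ S / p S` of the Jantzen-Schaper filtration,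
where `S(i) = {m | (m, S) ⊆ p ^ i R}`. -/
def jantzenSchaper (p : R) (i : ℕ) : Subrepresentation (reductionRep R lam p) where
  toSubmodule := ((jantzen R lam p i ⊔ pSpecht R lam p).toSubmodule).map
    (pSpecht R lam p).toSubmodule.mkQ
  apply_mem_toSubmodule g v hv := by
    obtain ⟨w, hw, rfl⟩ := hv
    exact ⟨spechtRep R lam g w,
      (jantzen R lam p i ⊔ pSpecht R lam p).apply_mem_toSubmodule g hw, rfl⟩

end

/-- The subquotient `B / (A ∩ B)` of a representation (that is `B / A` when `A ≤ B`). -/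
def subquotientRep {R G V : Type*} [CommRing R] [Group G] [AddCommGroup V] [Module R V]
    {ρ : Representation R G V} (B A : Subrepresentation ρ) :
    Representation R G (B.toSubmodule ⧸ A.toSubmodule.submoduleOf B.toSubmodule) :=
  B.toRepresentation.quotient (A.toSubmodule.submoduleOf B.toSubmodule)
    (fun g _ hx => A.apply_mem_toSubmodule g hx)

section

variable (O K : Type*) [CommRing O] [Field K] [Algebra O K] {n : ℕ} (lam : n.Partition)

/-- The Specht module over `K`, regarded as a representation over `O`. -/
def spechtRepRestrict : Representation O (Equiv.Perm (Fin n)) (SpechtModule K lam) where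
  toFun g := (spechtRep K lam g).restrictScalars O
  map_one' := by ext; simp
  map_mul' g h := by ext; simp

theorem algebraMap_polytabloid (t : Tableau lam) :
    (fun T => algebraMap O K (polytabloid O t T)) = polytabloid K t := by
  classical
  funext T
  simp [polytabloid, Finset.sum_apply, Pi.single_apply, apply_ite (algebraMap O K)]

/-- The map from the Specht module over `O` to the one over `K`, given by applying
`O → K` to all coefficients. -/
def spechtMap : SpechtModule O lam →ₗ[O] SpechtModule K lam where
  toFun x := ⟨fun T => algebraMap O K ((x : Tabloid lam → O) T), by
    obtain ⟨x, hx⟩ := x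
    change (fun T => algebraMap O K (x T)) ∈ Submodule.span K _
    induction hx using Submodule.span_induction with
    | mem x hx =>
      obtain ⟨t, rfl⟩ := hx
      rw [algebraMap_polytabloid]
      exact Submodule.subset_span ⟨t, rfl⟩
    | zero => simp only [Pi.zero_apply, map_zero]; exact zero_mem _
    | add x y _ _ hx hy =>
      simp only [Pi.add_apply, map_add]; exact add_mem hx hy
    | smul c x _ hx =>
      simp only [Pi.smul_apply, smul_eq_mul, map_mul]
      exact Submodule.smul_mem _ (algebraMap O K c) hx⟩
  map_add' x y := by
    refine Subtype.ext (funext fun T => ?_)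
    simp
  map_smul' c x := by
    refine Subtype.ext (funext fun T => ?_)
    simp [Algebra.smul_def]

/-- The Specht lattice over `O` inside the Specht module over `K`. -/
def spechtLattice : Subrepresentation (spechtRepRestrict O K lam) where
  toSubmodule := LinearMap.range (spechtMap O K lam)
  apply_mem_toSubmodule g v hv := by
    obtain ⟨w, rfl⟩ := hv
    exact ⟨spechtRep O lam g w, rfl⟩

/-- The dual `{l | (l, L) ⊆ O}` of a sublattice `L` of the Specht module over `K`. -/
def dual (L : Subrepresentation (spechtRepRestrict O K lam)) :
    Subrepresentation (spechtRepRestrict O K lam) where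
  toSubmodule := (spechtForm K lam).dualSubmodule L.toSubmodule
  apply_mem_toSubmodule g v hv y hy := by
    have h := hv _ (L.apply_mem_toSubmodule g⁻¹ hy)
    change spechtForm K lam (spechtRep K lam g v) y ∈ (1 : Submodule O K)
    rw [spechtForm_spechtRep]
    exact h

/-- The multiple `c L` of a sublattice `L` of the Specht module over `K`, for `c` in `K`. -/
def scale (c : K) (L : Subrepresentation (spechtRepRestrict O K lam)) :
    Subrepresentation (spechtRepRestrict O K lam) where
  toSubmodule := c • L.toSubmodule
  apply_mem_toSubmodule g v hv := by
    obtain ⟨w, hw, rfl⟩ := hv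
    exact ⟨_, L.apply_mem_toSubmodule g hw, (map_smul (spechtRep K lam g) c w).symm⟩

/-- The lattice `p ^ (-j) S ∩ S♯`, where `S` is the Specht lattice over `O` and `S♯` its dual. -/
def hatS (p : ℕ) (j : ℕ) : Subrepresentation (spechtRepRestrict O K lam) :=
  scale O K lam (((p : K) ^ j)⁻¹) (spechtLattice O K lam) ⊓ dual O K lam (spechtLattice O K lam)

end

end Specht

end

/-! Multiplication by `p ^ j` carries `hatS j` bijectively onto the image of `jantzen j`: if `m = p
^ j x` lies in the lattice `S`, then `(x, S) ⊆ O` says exactly `(m, S) ⊆ p ^ j O`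
(`mem_dual_iff_mem_jantzen`). Reducing `m` modulo `p S` gives an equivariant map from `hatS (j + 1)`
onto the Jantzen–Schaper term. Its kernel is given by `p ^ (j + 1) x ∈ p S`, that is `p ^ j x ∈ S`,
which is `hatS j`.

The chain reaches the dual once some `p ^ l` multiplies `S♯` into `S`. Positivity of the form makes
sense over `ℚ` but not over `K`; since polytabloids have integer coefficients, it is used over `ℚ`
to get an identity `E Y (Eᵀ E) = N E` over `ℤ`, which maps to `K`. If `x = E c` lies in `S♯`, then
`Eᵀ x` has entries in `O`, so `N x = E Y (Eᵀ x)` lies in `S`. -/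

/-! ### Generalized inverses of Gram matrices over the integers. -/

/-- Every integer matrix `E` satisfies `E Y (Eᵀ E) = N E` for some integer matrix `Y` and some
integer `N ≠ 0`: the rational matrix `Eᵀ E` has a generalized inverse and the same kernel as `E`. -/
theorem Matrix.exists_mul_transpose_mul_self_eq_smul {m ι : Type*} [Fintype m] [Fintype ι]
    (E : Matrix m ι ℤ) :
    ∃ N : ℤ, N ≠ 0 ∧ ∃ Y : Matrix ι ι ℤ, E * (Y * (E.transpose * E)) = N • E := by
  classical
  let A : Matrix m ι ℚ := E.map (Int.castRingHom ℚ)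
  obtain ⟨Z, hZ⟩ : ∃ Z : Matrix ι ι ℚ, A * (Z * (A.transpose * A)) = A := by
    let f := Matrix.toLin' (A.transpose * A)
    -- A section of `f` over its range, extended to the whole space, is a generalized inverse of
    -- `f`.
    obtain ⟨s, hs⟩ := f.rangeRestrict.exists_rightInverse_of_surjective f.range_rangeRestrict
    obtain ⟨Z, hZ⟩ := LinearMap.exists_extend s
    refine ⟨LinearMap.toMatrix' Z, ?_⟩
    have h1 : f ∘ₗ Z ∘ₗ f = f := by
      refine LinearMap.ext fun v => ?_
      have h2 : Z (f v) = s (f.rangeRestrict v) := LinearMap.congr_fun hZ (f.rangeRestrict v)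
      have h3 := congrArg Subtype.val (LinearMap.congr_fun hs (f.rangeRestrict v))
      simp only [LinearMap.comp_apply, h2]
      exact h3
    have h4 : (A.transpose * A) * (LinearMap.toMatrix' Z * (A.transpose * A))
        = A.transpose * A := by
      have h := congrArg LinearMap.toMatrix' h1
      rwa [LinearMap.toMatrix'_comp, LinearMap.toMatrix'_comp, LinearMap.toMatrix'_toLin'] at h
    have h5 : A.conjTranspose = A.transpose := by ext; simp [Matrix.conjTranspose_apply]
    -- Over `ℚ` a vanishing sum of squares has zero terms, so the left factor `Aᵀ` can be cancelled.
    have h6 := (Matrix.conjTranspose_mul_self_mul_eq_zero A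
      (LinearMap.toMatrix' Z * (A.transpose * A) - 1)).1
      (by rw [h5, Matrix.mul_sub, h4, Matrix.mul_one, sub_self])
    rwa [Matrix.mul_sub, Matrix.mul_one, sub_eq_zero] at h6
  -- `b` is a common denominator of the entries of `Z`; it serves as `N`.
  obtain ⟨b, hb⟩ := IsLocalization.exist_integer_multiples_of_finite (nonZeroDivisors ℤ)
    (fun ij : ι × ι => Z ij.1 ij.2)
  choose y hy using hb
  let Y : Matrix ι ι ℤ := Matrix.of fun i j => y (i, j)
  have hY : Y.map (Int.castRingHom ℚ) = ((b : ℤ) : ℚ) • Z := by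
    ext i j
    simpa [Y] using hy (i, j)
  refine ⟨b, nonZeroDivisors.coe_ne_zero b, Y, ?_⟩
  apply Matrix.map_injective (Int.castRingHom ℚ).injective_int
  simp only [Matrix.map_mul, hY]
  change A * ((_ • Z) * (A.transpose * A)) = _
  rw [Matrix.smul_mul, Matrix.mul_smul, hZ]
  ext i j
  simp [A]

namespace Specht

/-- One integer matrix describes the polytabloids over every ring, so matrix identities over `ℤ`
pass to `O` and `K`. -/
theorem polytabloid_apply_eq_intCast (R : Type*) [CommRing R] {n : ℕ} {lam : n.Partition}
    (t : Tableau lam) (T : Tabloid lam) :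
    polytabloid R t T = ((polytabloid ℤ t T : ℤ) : R) := by
  classical
  simp [polytabloid, Finset.sum_apply, Pi.single_apply]

/-- An equivariant map on `B` with kernel `A ∩ B` and image `C` identifies `B / A` with `C`. -/
theorem nonempty_subquotientRep_equiv {R G V W : Type*} [CommRing R] [Group G] [AddCommGroup V]
    [Module R V] [AddCommGroup W] [Module R W] {ρ : Representation R G V}
    {σ : Representation R G W} {B A : Subrepresentation ρ} {C : Subrepresentation σ}
    (f : B.toSubmodule →ₗ[R] W)
    (hker : LinearMap.ker f = A.toSubmodule.submoduleOf B.toSubmodule)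
    (hrange : LinearMap.range f = C.toSubmodule)
    (hf : ∀ g x, f (B.toRepresentation g x) = σ g (f x)) :
    Nonempty ((subquotientRep B A).Equiv C.toRepresentation) := by
  let e := (Submodule.quotEquivOfEq _ _ hker.symm).trans
    (f.quotKerEquivRange.trans (LinearEquiv.ofEq (LinearMap.range f) _ hrange))
  exact ⟨Representation.Equiv.mk e fun g =>
    Submodule.linearMap_qext _ (LinearMap.ext fun x => Subtype.ext (hf g x))⟩

/-! ### Membership in the lattice, its dual and `hatS`. -/

section

variable {O K : Type*} [CommRing O] [Field K] [Algebra O K] {n : ℕ} {lam : n.Partition}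

theorem spechtMap_injective [IsDomain O] [IsFractionRing O K] :
    Function.Injective (spechtMap O K lam) := fun _ _ h =>
  Subtype.ext (funext fun T => IsFractionRing.injective O K (congrFun (congrArg Subtype.val h) T))

theorem spechtMap_spechtRep (g : Equiv.Perm (Fin n)) (x : SpechtModule O lam) :
    spechtMap O K lam (spechtRep O lam g x)
      = spechtRepRestrict O K lam g (spechtMap O K lam x) := rfl

theorem spechtForm_spechtMap (x y : SpechtModule O lam) :
    spechtForm K lam (spechtMap O K lam x) (spechtMap O K lam y)
      = algebraMap O K (spechtForm O lam x y) := by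
  simp [spechtForm_apply, spechtMap]

theorem mem_spechtLattice {x : SpechtModule K lam} :
    x ∈ (spechtLattice O K lam).toSubmodule ↔ ∃ m, spechtMap O K lam m = x := Iff.rfl

theorem mem_dual_spechtLattice {x : SpechtModule K lam} :
    x ∈ (dual O K lam (spechtLattice O K lam)).toSubmodule ↔
      ∀ y, ∃ a : O, algebraMap O K a = spechtForm K lam x (spechtMap O K lam y) := by
  change (∀ y ∈ LinearMap.range (spechtMap O K lam), spechtForm K lam x y ∈ (1 : Submodule O K)) ↔ _
  simp only [LinearMap.mem_range, forall_exists_index, forall_apply_eq_imp_iff, Submodule.mem_one]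

theorem spechtLattice_le_dual :
    spechtLattice O K lam ≤ dual O K lam (spechtLattice O K lam) := by
  rintro _ ⟨m, rfl⟩
  exact mem_dual_spechtLattice.2 fun y => ⟨_, (spechtForm_spechtMap m y).symm⟩

theorem mem_hatS {p : ℕ} (hp : (p : K) ≠ 0) {j : ℕ} {x : SpechtModule K lam} :
    x ∈ (hatS O K lam p j).toSubmodule ↔
      (∃ m, spechtMap O K lam m = (p : O) ^ j • x) ∧
        x ∈ (dual O K lam (spechtLattice O K lam)).toSubmodule := by
  have hs : ((p : O) ^ j) • x = ((p : K) ^ j) • x := by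
    rw [← algebraMap_smul K, map_pow, map_natCast]
  refine and_congr_left fun _ => ?_
  rw [hs]
  change x ∈ (((p : K) ^ j)⁻¹ • (spechtLattice O K lam).toSubmodule) ↔ _
  rw [← mem_spechtLattice, ← SetLike.mem_coe, Submodule.coe_pointwise_smul,
    Set.mem_inv_smul_set_iff₀ (pow_ne_zero j hp), SetLike.mem_coe]

/-- Here `(m, y) = p ^ j (x, y)`, and the factor `p ^ j` cancels in `K`. -/
theorem mem_dual_iff_mem_jantzen [IsDomain O] [IsFractionRing O K] {p : O} (hp : p ≠ 0) {j : ℕ}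
    {x : SpechtModule K lam} {m : SpechtModule O lam} (h : spechtMap O K lam m = p ^ j • x) :
    x ∈ (dual O K lam (spechtLattice O K lam)).toSubmodule ↔
      m ∈ (jantzen O lam p j).toSubmodule := by
  have hp' : algebraMap O K p ≠ 0 := by simpa using hp
  rw [mem_dual_spechtLattice]
  change _ ↔ ∀ y, p ^ j ∣ spechtForm O lam m y
  refine forall_congr' fun y => exists_congr fun a => ?_
  have h1 : algebraMap O K (spechtForm O lam m y)
      = algebraMap O K p ^ j * spechtForm K lam x (spechtMap O K lam y) := by
    rw [← spechtForm_spechtMap, h, ← algebraMap_smul K, map_smul, LinearMap.smul_apply, map_pow,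
      smul_eq_mul]
  rw [← (IsFractionRing.injective O K).eq_iff, h1, map_mul, map_pow,
    mul_right_inj' (pow_ne_zero j hp'), eq_comm]

/-! ### The dual has bounded denominators. -/

/-- A nonzero integer multiplies the dual of the Specht lattice into the lattice. -/
theorem exists_smul_mem_spechtLattice (O K : Type*) [CommRing O] [Field K] [Algebra O K] {n : ℕ}
    (lam : n.Partition) :
    ∃ N : ℤ, N ≠ 0 ∧ ∀ x ∈ (dual O K lam (spechtLattice O K lam)).toSubmodule,
      N • x ∈ (spechtLattice O K lam).toSubmodule := by
  classical
  have : Finite (Tableau lam) := inferInstanceAs (Finite (Fin n ≃ (diagram lam).cells))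
  have : Fintype (Tableau lam) := Fintype.ofFinite _
  let E : Matrix (Tabloid lam) (Tableau lam) ℤ := Matrix.of fun T t => polytabloid ℤ t T
  obtain ⟨N, hN, Y, hY⟩ := E.exists_mul_transpose_mul_self_eq_smul
  refine ⟨N, hN, fun x hx => ?_⟩
  let F : Matrix (Tabloid lam) (Tableau lam) K := E.map (Int.castRingHom K)
  have hF : F * (Y.map (Int.castRingHom K) * (F.transpose * F)) = (N : K) • F := by
    have h := congrArg (fun M => M.map (Int.castRingHom K)) hY
    simp only [Matrix.map_mul] at h
    refine h.trans ?_
    ext i j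
    simp [F]
  -- All polytabloids are used, so `c` need not be unique; no basis of the Specht module is
  -- required.
  obtain ⟨c, hc⟩ := (Submodule.mem_span_range_iff_exists_fun K).1 x.2
  have hxc : (x : Tabloid lam → K) = F.mulVec c := by
    rw [← hc]
    funext T
    simp [Matrix.mulVec, dotProduct, F, E, polytabloid_apply_eq_intCast K, mul_comm]
  let e : Tableau lam → SpechtModule O lam := fun t =>
    ⟨polytabloid O t, Submodule.subset_span ⟨t, rfl⟩⟩
  choose a ha using fun t => mem_dual_spechtLattice.1 hx (e t)
  have hFa : F.transpose.mulVec x = fun t => algebraMap O K (a t) := by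
    funext t
    rw [ha, spechtForm_apply]
    refine Finset.sum_congr rfl fun T _ => ?_
    simp [F, E, e, spechtMap, polytabloid_apply_eq_intCast O, mul_comm]
  -- The coefficients are the entries of `Y (Fᵀ x)`; they lie in `O` because `Fᵀ x` lists the
  -- pairings of `x` with the polytabloids.
  refine ⟨∑ t, (∑ s, (Y t s : O) * a s) • e t, Subtype.ext ?_⟩
  have hNx : ((N • x : SpechtModule K lam) : Tabloid lam → K)
      = F.mulVec ((Y.map (Int.castRingHom K)).mulVec fun t => algebraMap O K (a t)) := by
    rw [← hFa, hxc, Matrix.mulVec_mulVec, Matrix.mulVec_mulVec, Matrix.mulVec_mulVec,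
      Matrix.mul_assoc, Matrix.mul_assoc, hF, Matrix.smul_mulVec, ← hxc]
    exact (Int.cast_smul_eq_zsmul K N _).symm
  rw [hNx]
  funext T
  change algebraMap O K (((∑ t, (∑ s, (Y t s : O) * a s) • e t : SpechtModule O lam) :
    Tabloid lam → O) T) = _
  simp [Matrix.mulVec, dotProduct, F, E, e, polytabloid_apply_eq_intCast O, mul_comm]

end

/-! ### The successive quotients. -/

section

variable {O K : Type*} [CommRing O] [IsDomain O] [Field K] [Algebra O K] [IsFractionRing O K]
  {n : ℕ} {lam : n.Partition}

/-- The map `x ↦ p ^ j x + p S` from `hatS` to the reduction of the Specht module. -/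
theorem exists_hatS_linearMap {p : ℕ} (hp : (p : K) ≠ 0) (j : ℕ) :
    ∃ f : (hatS O K lam p j).toSubmodule →ₗ[O]
        SpechtModule O lam ⧸ (pSpecht O lam (p : O)).toSubmodule,
      ∀ (x : (hatS O K lam p j).toSubmodule) m,
        spechtMap O K lam m = (p : O) ^ j • (x : SpechtModule K lam) →
        f x = (pSpecht O lam (p : O)).toSubmodule.mkQ m := by
  let e := LinearEquiv.ofInjective (spechtMap O K lam) spechtMap_injective
  let g : (hatS O K lam p j).toSubmodule →ₗ[O] LinearMap.range (spechtMap O K lam) :=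
    (((p : O) ^ j) • (hatS O K lam p j).toSubmodule.subtype).codRestrict _
      fun x => ((mem_hatS hp).1 x.2).1
  refine ⟨(pSpecht O lam (p : O)).toSubmodule.mkQ ∘ₗ e.symm.toLinearMap ∘ₗ g, fun x m h => ?_⟩
  have : e.symm (g x) = m := by
    rw [LinearEquiv.symm_apply_eq]
    exact Subtype.ext h.symm
  simp [this]

/-- `hatS (j + 1) / hatS j` is isomorphic to the `(j + 1)`-st term of the
Jantzen-Schaper filtration. -/
theorem nonempty_subquotientRep_hatS_equiv {p : ℕ} (hp : (p : K) ≠ 0) (j : ℕ) :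
    Nonempty ((subquotientRep (hatS O K lam p (j + 1)) (hatS O K lam p j)).Equiv
      (jantzenSchaper O lam (p : O) (j + 1)).toRepresentation) := by
  have hpO : (p : O) ≠ 0 := fun h => hp (by rw [← map_natCast (algebraMap O K), h, map_zero])
  have hpM : Function.Injective fun x : SpechtModule K lam => (p : O) • x := by
    intro x y h
    simp only [← algebraMap_smul K (p : O), map_natCast] at h
    exact smul_right_injective _ hp h
  obtain ⟨f, hf⟩ := exists_hatS_linearMap (O := O) (lam := lam) hp (j + 1)
  have hmem : ∀ x : (hatS O K lam p (j + 1)).toSubmodule,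
      ∃ m ∈ (jantzen O lam (p : O) (j + 1)).toSubmodule,
      spechtMap O K lam m = (p : O) ^ (j + 1) • (x : SpechtModule K lam) ∧
      f x = (pSpecht O lam (p : O)).toSubmodule.mkQ m := fun x => by
    obtain ⟨⟨m, hm⟩, hx⟩ := (mem_hatS hp).1 x.2
    exact ⟨m, (mem_dual_iff_mem_jantzen hpO hm).1 hx, hm, hf x m hm⟩
  -- Membership of `x` in the dual is already known, so only the condition `m = p w` remains;
  -- cancelling one `p` turns it into `p ^ j x = w`.
  have hker : LinearMap.ker f
      = (hatS O K lam p j).toSubmodule.submoduleOf (hatS O K lam p (j + 1)).toSubmodule := by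
    ext x
    obtain ⟨m, -, hm, hfm⟩ := hmem x
    have hx := ((mem_hatS hp).1 x.2).2
    rw [LinearMap.mem_ker, hfm, Submodule.mkQ_apply, Submodule.Quotient.mk_eq_zero,
      Submodule.submoduleOf, Submodule.mem_comap, Submodule.subtype_apply, mem_hatS hp, and_iff_left hx]
    change (∃ w, w ∈ (⊤ : Submodule O _) ∧ (p : O) • w = m) ↔ _
    simp only [Submodule.mem_top, true_and]
    refine exists_congr fun w => ?_
    rw [← spechtMap_injective.eq_iff (f := spechtMap O K lam), hm, map_smul, pow_succ', mul_smul]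
    exact hpM.eq_iff
  have hrange : LinearMap.range f = (jantzenSchaper O lam (p : O) (j + 1)).toSubmodule := by
    apply le_antisymm
    · rintro _ ⟨x, rfl⟩
      obtain ⟨m, hm, -, hfm⟩ := hmem x
      exact ⟨m, Submodule.mem_sup_left hm, hfm.symm⟩
    · rintro _ ⟨w, hw, rfl⟩
      obtain ⟨m, hm, q, hq, rfl⟩ := Submodule.mem_sup.1 hw
      -- The preimage is `p ^ (-(j + 1)) m`; the summand `q` in `p S` dies in the quotient.
      have hm' : spechtMap O K lam m = (p : O) ^ (j + 1) •
          ((p : K) ^ (j + 1))⁻¹ • spechtMap O K lam m := by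
        rw [← algebraMap_smul K ((p : O) ^ (j + 1)), map_pow, map_natCast,
          smul_inv_smul₀ (pow_ne_zero _ hp)]
      refine ⟨⟨((p : K) ^ (j + 1))⁻¹ • spechtMap O K lam m,
        (mem_hatS hp).2 ⟨⟨m, hm'⟩, (mem_dual_iff_mem_jantzen hpO hm').2 hm⟩⟩, ?_⟩
      rw [hf _ m hm', map_add, Submodule.mkQ_apply _ q, (Submodule.Quotient.mk_eq_zero _).2 hq,
        add_zero]
  refine nonempty_subquotientRep_equiv f hker hrange fun g x => ?_
  obtain ⟨m, -, hm, hfm⟩ := hmem x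
  -- The value of `f` may be read off from any lift, and `g m` is a lift for `g x`.
  have hg : spechtMap O K lam (spechtRep O lam g m) = (p : O) ^ (j + 1) •
      (((hatS O K lam p (j + 1)).toRepresentation g x : (hatS O K lam p (j + 1)).toSubmodule) :
        SpechtModule K lam) := by
    rw [spechtMap_spechtRep, hm, map_smul]
    rfl
  rw [hfm, hf _ _ hg]
  rfl

end

end Specht

theorem mainTheorem8 (p : ℕ) (hp : p.Prime)
    (O : Type*) [CommRing O] [IsDomain O] [IsDiscreteValuationRing O] [CharZero O]
    (hO : IsLocalRing.maximalIdeal O = Ideal.span {(p : O)})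
    (K : Type*) [Field K] [Algebra O K] [IsFractionRing O K]
    (n : ℕ) (lam : n.Partition) :
    Specht.hatS O K lam p 0 = Specht.spechtLattice O K lam ∧
    (∀ j : ℕ, Specht.hatS O K lam p j ≤ Specht.hatS O K lam p (j + 1)) ∧
    (∃ l : ℕ, Specht.hatS O K lam p l = Specht.dual O K lam (Specht.spechtLattice O K lam)) ∧
    (∀ j : ℕ, Nonempty
      ((Specht.subquotientRep (Specht.hatS O K lam p (j + 1)) (Specht.hatS O K lam p j)).Equiv
        (Specht.jantzenSchaper O lam (p : O) (j + 1)).toRepresentation)) := by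
  have hpK : (p : K) ≠ 0 := by
    rw [← map_natCast (algebraMap O K)]
    exact (map_ne_zero_iff _ (IsFractionRing.injective O K)).2 (Nat.cast_ne_zero.2 hp.ne_zero)
  refine ⟨?_, fun j x hx => ?_, ?_, Specht.nonempty_subquotientRep_hatS_equiv hpK⟩
  · refine SetLike.ext fun x => (Specht.mem_hatS hpK).trans ?_
    rw [pow_zero, one_smul]
    exact ⟨fun h => h.1, fun h => ⟨h, Specht.spechtLattice_le_dual h⟩⟩
  · obtain ⟨⟨m, hm⟩, hd⟩ := (Specht.mem_hatS hpK).1 hx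
    refine (Specht.mem_hatS hpK).2 ⟨⟨(p : O) • m, ?_⟩, hd⟩
    rw [map_smul, hm, pow_succ', mul_smul]
  · obtain ⟨N, hN, h⟩ := Specht.exists_smul_mem_spechtLattice O K lam
    have hirr : Irreducible (p : O) :=
      (IsDiscreteValuationRing.irreducible_iff_uniformizer _).2 hO
    -- `l` is the `p`-adic valuation of `N`, nonzero in `O` by characteristic `0`. With `m = N x`,
    -- dividing by the unit `u` gives `p ^ l x`.
    obtain ⟨l, u, hu⟩ := IsDiscreteValuationRing.eq_unit_mul_pow_irreducible
      (Int.cast_ne_zero.2 hN : (N : O) ≠ 0) hirr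
    refine ⟨l, SetLike.ext fun x => (Specht.mem_hatS hpK).trans ⟨fun hx => hx.2, fun hx => ?_⟩⟩
    obtain ⟨m, hm⟩ := h x hx
    refine ⟨⟨(↑u⁻¹ : O) • m, ?_⟩, hx⟩
    rw [map_smul, hm, ← Int.cast_smul_eq_zsmul O, hu, smul_smul, Units.inv_mul_cancel_left]
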